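/- **Theorem.** Let $\mathcal{G}$ be the class of connected finite simple graphs of degeneracy $2$ and diameter at most $6$, and let $C_6$-free denote the set of graphs that have no (not necessarily induced) subgraph isomorphic to the cycle $C_6$. In a network with $n$ nodes, the nodes have pairwise distinct identifiers in $\{1,\dots,N(n)\}$ and all know $N(n)$, where $n\le N(n)\le \mathrm{poly}(n)$. (1) Every deterministic $\mathsf{CONGEST}$ algorithm (synchronous rounds; in each round every node sends a message of $O(\log n)$ bits to each of its neighbors, and local computation is unlimited) that decides membership in $C_6$-free under the promise that the input graph belongs to $\mathcal{G}$ (all nodes terminate, and the graph is $C_6$-free if and only if all nodes accept) has round complexity $R(n)=\tilde\Omega(\sqrt n)$, where $R(n)$ is the maximum number of rounds until all nodes have terminated, over all networks in $\mathcal{G}$ with at most $n$ nodes. Precisely: there is a constant $p$ and, for every $B$, there are $c>0$ and $n_0$ such that $R(n)\ge c\sqrt n/(\log n)^p$ for all $n\ge n_0$ and for every such algorithm whose messages have at most $B\lfloor\log_2 n\rfloor$ bits in $n$-node networks in $\mathcal{G}$. (2) A certification scheme is a pair of a prover, which assigns to each node of a network a bit string (its certificate), and a verifier, in which each node accepts or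 rejects as a function of $N(n)$, its identifier, its certificate, and the identifiers and certificates of its neighbors. Suppose that it certifies membership in $C_6$-free under the promise that the input graph belongs to $\mathcal{G}$: if the graph is $C_6$-free, then all nodes accept the certificates assigned by the prover, and if it is not, then for every assignment of certificates at least one node rejects. Then the scheme uses certificates of size $\tilde\Omega(\sqrt n)$: there are absolute constants $p$, $c>0$ and $n_0$ such that for every such scheme and every $n\ge n_0$, the maximum length of a certificate assigned by the prover in a $C_6$-free $n$-node network in $\mathcal{G}$ is at least $c\sqrt n/(\log n)^p$. -/

import Mathlib

open scoped ENNReal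

noncomputable section

namespace Congest

/-! ### Graphs -/

/-- `G` is `k`-degenerate: every nonempty subgraph has a vertex of degree at most `k`
in that subgraph. -/
def IsDegenerate {V : Type*} (G : SimpleGraph V) (k : ℕ) : Prop :=
  ∀ H : G.Subgraph, H.verts.Nonempty → ∃ v ∈ H.verts, (H.neighborSet v).encard ≤ k

/-- The degeneracy of `G`: the least `k` such that `G` is `k`-degenerate (`⊤` if there is none,
which does not happen for finite graphs). -/
def degeneracy {V : Type*} (G : SimpleGraph V) : ℕ∞ :=
  ⨅ (k : ℕ) (_ : IsDegenerate G k), (k : ℕ∞)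

/-- A class of finite graphs (on the vertex sets `Fin n`); also used for graph properties. -/
abbrev GraphClass : Type := ∀ n : ℕ, SimpleGraph (Fin n) → Prop

/-- The graphs of degeneracy `2` and of diameter at most `6`. -/
def degTwoDiamSix : GraphClass := fun _ G => degeneracy G = 2 ∧ G.ediam ≤ 6

/-- The graphs with no (not necessarily induced) subgraph isomorphic to the cycle `C₆`. -/
def C6Free : GraphClass := fun _ G => (SimpleGraph.cycleGraph 6).Free G

/-! ### Networks -/

/-- An `n`-node network: a connected simple graph with pairwise distinct node identifiers
in `{1, …, N n}`. Here `N n` is the upper bound on the number of nodes which is known to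
all nodes. -/
structure Network (N : ℕ → ℕ) (n : ℕ) where
  graph : SimpleGraph (Fin n)
  connected : graph.Connected
  ident : Fin n → ℕ
  ident_injective : Function.Injective ident
  ident_mem : ∀ v, ident v ∈ Finset.Icc 1 (N n)

open scoped Classical in
/-- The neighbors of a node. -/
def Network.nbrs {N : ℕ → ℕ} {n : ℕ} (G : Network N n) (v : Fin n) : Finset (Fin n) :=
  Finset.univ.filter fun u => G.graph.Adj v u

/-- `N` is a polynomially bounded upper bound on the number of nodes. -/
def IsPolyBound (N : ℕ → ℕ) : Prop :=
  (∀ n, n ≤ N n) ∧ ∃ k : ℕ, ∀ n, N n ≤ n ^ k + k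

/-! ### The CONGEST model -/

/-- A deterministic synchronous message-passing algorithm.
* `init M i S` is the initial state of a node with identifier `i` whose neighbors have the
  identifiers in `S`, when the known bound on the number of nodes is `M`.
* `send s j` is the bit string which a node in state `s` sends to its neighbor with
  identifier `j`.
* `step s R` is the new state of a node in state `s` which has received the messages in `R`,
  a set of pairs (identifier of the sender, message).
* `output s` is `some b` if a node in state `s` has terminated with decision `b`
  (`true` = accept), and `none` if it is still running. -/
structure Algorithm where
  State : Type
  init : ℕ → ℕ → Finset ℕ → State
  send : State → ℕ → List Bool
  step : State → Finset (ℕ × List Bool) → State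
  output : State → Option Bool

namespace Algorithm

variable (A : Algorithm) {N : ℕ → ℕ} {n : ℕ} (G : Network N n)

open scoped Classical in
/-- The messages received by `v` when the nodes are in the states `σ`; terminated nodes
are silent. -/
def inbox (σ : Fin n → A.State) (v : Fin n) : Finset (ℕ × List Bool) :=
  ((G.nbrs v).filter fun u => A.output (σ u) = none).image
    fun u => (G.ident u, A.send (σ u) (G.ident v))

/-- The states of the nodes after `t` rounds; terminated nodes keep their state. -/
def stateAt : ℕ → Fin n → A.State
  | 0, v => A.init (N n) (G.ident v) ((G.nbrs v).image G.ident)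
  | t + 1, v =>
    if A.output (stateAt t v) = none then
      A.step (stateAt t v) (A.inbox G (stateAt t) v)
    else stateAt t v

/-- All nodes have terminated after `t` rounds. -/
def HaltedAt (t : ℕ) : Prop := ∀ v, A.output (A.stateAt G t v) ≠ none

/-- The number of rounds performed until all nodes have terminated (`⊤` if this never
happens). -/
def rounds : ℕ∞ := ⨅ (t : ℕ) (_ : A.HaltedAt G t), (t : ℕ∞)

/-- The node `v` eventually terminates and accepts. -/
def AcceptsAt (v : Fin n) : Prop := ∃ t, A.output (A.stateAt G t v) = some true

/-- In an `n`-node network of the class `𝒢`, every message which is sent has at most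
`B * log₂ n` bits. -/
def HasBandwidth (N : ℕ → ℕ) (𝒢 : GraphClass) (B : ℕ) : Prop :=
  ∀ (n : ℕ) (G : Network N n), 𝒢 n G.graph → ∀ (t : ℕ) (u v : Fin n), G.graph.Adj u v →
    A.output (A.stateAt G t u) = none →
      (A.send (A.stateAt G t u) (G.ident v)).length ≤ B * Nat.log 2 n

/-- `A` decides the property `P` under the promise that the input graph is in `𝒢`: all nodes
terminate, and the graph has the property if and only if all nodes accept. -/
def Decides (N : ℕ → ℕ) (𝒢 P : GraphClass) : Prop :=
  ∀ (n : ℕ) (G : Network N n), 𝒢 n G.graph →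
    (∃ t, A.HaltedAt G t) ∧ (P n G.graph ↔ ∀ v, A.AcceptsAt G v)

/-- The round complexity of `A` on the class `𝒢`: the maximum number of rounds performed in a
network in `𝒢` with at most `n` nodes. -/
def roundComplexity (N : ℕ → ℕ) (𝒢 : GraphClass) (n : ℕ) : ℕ∞ :=
  ⨆ (m : ℕ) (_ : m ≤ n) (G : Network N m) (_ : 𝒢 m G.graph), A.rounds G

end Algorithm

/-! ### Distributed certification -/

/-- A pair prover-verifier. The prover assigns a certificate to every node of a network.
`verifier M i x R` is the decision of a node with identifier `i` and certificate `x`, where `M`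
is the known bound on the number of nodes and `R` is the set of pairs (identifier, certificate)
of its neighbors. -/
structure CertScheme (N : ℕ → ℕ) where
  prover : ∀ {n : ℕ}, Network N n → Fin n → List Bool
  verifier : ℕ → ℕ → List Bool → Finset (ℕ × List Bool) → Bool

namespace CertScheme

variable {N : ℕ → ℕ} (S : CertScheme N)

/-- The node `v` accepts when the nodes hold the certificates `x`. -/
def AcceptsAt {n : ℕ} (G : Network N n) (x : Fin n → List Bool) (v : Fin n) : Prop :=
  S.verifier (N n) (G.ident v) (x v) ((G.nbrs v).image fun u => (G.ident u, x u)) = true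

/-- The scheme certifies the property `P` under the promise that the input graph is in `𝒢`
(completeness and soundness). -/
def Certifies (𝒢 P : GraphClass) : Prop :=
  ∀ (n : ℕ) (G : Network N n), 𝒢 n G.graph →
    (P n G.graph → ∀ v, S.AcceptsAt G (S.prover G) v) ∧
    (¬ P n G.graph → ∀ x : Fin n → List Bool, ∃ v, ¬ S.AcceptsAt G x v)

/-- The certificate size: the maximum length of a certificate which the prover assigns in an
`n`-node network in `𝒢` with the property `P`. -/
def certSize (𝒢 P : GraphClass) (n : ℕ) : ℕ∞ :=
  ⨆ (G : Network N n) (_ : 𝒢 n G.graph) (_ : P n G.graph) (v : Fin n),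
    ((S.prover G v).length : ℕ∞)

end CertScheme

end Congest

end

namespace Congest

/-! The lower bound is a reduction from set disjointness on `m ^ 2` elements, in fooling-set form.
Each of two sides encodes a subset of `Fin m × Fin m` as a subdivided bipartite graph, in which
`link s i j` is attached to `right s j` exactly when the pair is present; otherwise it stays as a
leaf, so the vertex set is independent of the input. Matchings join the two copies of each `left`
and each `right` vertex, so a pair present on both sides closes a 6-cycle, and
`not_cycleGraph_six_free_gadget_iff` shows that there are no others. The hub bounds the diameter by
6. It is reached in 2 steps from `left` but in 3 from `right`, since two paths of length 2 would
close a 6-cycle with any complete link.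

Only `4 * m` edges cross between the sides. Giving a set to one side and its complement to the other
yields `2 ^ (m ^ 2)` inputs without a 6-cycle. If too little information sits at the cut, two of
them agree there (`exists_fooling_pair`). Gluing one side of each gives a network in which every
node sees what it saw before and accepts (`Algorithm.stateAt_hybrid`,
`CertScheme.acceptsAt_hybrid`), although the two sides now intersect. Hence `m ^ 2` is at most of
order `m` times the information per cut edge, and `m` can be chosen of order `√n`. -/

/-! ### Criteria for degeneracy, diameter and 6-cycles -/

/-- A graph is `k`-degenerate if, for some ranking of the vertices, every vertex has at most `k`
neighbors of no smaller rank. -/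
theorem isDegenerate_of_rank {V : Type*} {G : SimpleGraph V} {k : ℕ} (ρ : V → ℕ)
    (h : ∀ v, {u | G.Adj v u ∧ ρ v ≤ ρ u}.encard ≤ k) : IsDegenerate G k := by
  intro H hH
  -- A vertex of minimal rank in `H` has only `H`-neighbors of no smaller rank.
  obtain ⟨v, hv, hmin⟩ := Function.argminOn_mem ρ H.verts hH |> fun hm =>
    (⟨_, hm, fun u hu => Function.argminOn_le ρ H.verts hu⟩ :
      ∃ v ∈ H.verts, ∀ u ∈ H.verts, ρ v ≤ ρ u)
  refine ⟨v, hv, le_trans (Set.encard_le_encard ?_) (h v)⟩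
  intro u hu
  exact ⟨H.adj_sub hu, hmin u (H.edge_vert hu.symm)⟩

/-- If every vertex of a nonempty set has two neighbors in this set, then the graph is not
`1`-degenerate. -/
theorem two_le_of_isDegenerate {V : Type*} {G : SimpleGraph V} {k : ℕ} (hG : IsDegenerate G k)
    {U : Set V} (hU : U.Nonempty)
    (h : ∀ v ∈ U, ∃ a ∈ U, ∃ b ∈ U, a ≠ b ∧ G.Adj v a ∧ G.Adj v b) : 2 ≤ k := by
  obtain ⟨v, hv, hk⟩ := hG ((⊤ : G.Subgraph).induce U) (by simpa using hU)
  have hv' : v ∈ U := by simpa using hv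
  obtain ⟨a, ha, b, hb, hab, hva, hvb⟩ := h v hv'
  have hsub : ({a, b} : Set V) ⊆ ((⊤ : G.Subgraph).induce U).neighborSet v := by
    rintro w (rfl | rfl)
    · simp [hv', ha, hva]
    · simp [hv', hb, hvb]
  have := (Set.encard_le_encard hsub).trans hk
  rw [Set.encard_pair hab] at this
  exact_mod_cast this

theorem degeneracy_eq_two {V : Type*} {G : SimpleGraph V} (ρ : V → ℕ)
    (hρ : ∀ v, {u | G.Adj v u ∧ ρ v ≤ ρ u}.encard ≤ 2) {U : Set V} (hU : U.Nonempty)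
    (h : ∀ v ∈ U, ∃ a ∈ U, ∃ b ∈ U, a ≠ b ∧ G.Adj v a ∧ G.Adj v b) : degeneracy G = 2 := by
  apply le_antisymm
  · exact iInf₂_le_of_le 2 (isDegenerate_of_rank ρ (by exact_mod_cast hρ)) le_rfl
  · refine le_iInf₂ fun k hk => ?_
    exact_mod_cast two_le_of_isDegenerate hk hU h

theorem isDegenerate_of_embedding {V W : Type*} {G : SimpleGraph V} {G' : SimpleGraph W}
    (f : G ↪g G') {k : ℕ} (h : IsDegenerate G' k) : IsDegenerate G k := by
  intro H hH
  obtain ⟨w, hw, hk⟩ := h (H.map f.toHom) (by simpa using hH)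
  obtain ⟨v, hv, rfl⟩ : ∃ v ∈ H.verts, f v = w := by simpa using hw
  refine ⟨v, hv, le_trans ?_ hk⟩
  rw [← f.injective.encard_image]
  refine Set.encard_le_encard ?_
  rintro _ ⟨u, hu, rfl⟩
  exact ⟨v, u, hu, rfl, rfl⟩

theorem degeneracy_congr {V W : Type*} {G : SimpleGraph V} {G' : SimpleGraph W} (f : G ≃g G') :
    degeneracy G = degeneracy G' := by
  have : ∀ k, IsDegenerate G k ↔ IsDegenerate G' k := fun k =>
    ⟨isDegenerate_of_embedding f.symm.toEmbedding, isDegenerate_of_embedding f.toEmbedding⟩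
  simp only [degeneracy, this]

theorem edist_map_le {V W : Type*} {G : SimpleGraph V} {G' : SimpleGraph W} (f : G →g G')
    (u v : V) : G'.edist (f u) (f v) ≤ G.edist u v := by
  refine le_iInf fun w => ?_
  simpa using SimpleGraph.edist_le (w.map f)

theorem ediam_le_of_iso {V W : Type*} {G : SimpleGraph V} {G' : SimpleGraph W} (f : G ≃g G')
    {k : ℕ∞} (h : G'.ediam ≤ k) : G.ediam ≤ k := by
  refine SimpleGraph.ediam_le_of_edist_le fun u v => ?_
  have := edist_map_le f.symm.toHom (f u) (f v)
  simp only [RelIso.coe_toRelEmbedding, RelEmbedding.coe_toRelHom, RelIso.symm_apply_apply] at this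
  exact this.trans (SimpleGraph.edist_le_ediam.trans h)

theorem edist_le_add_one {V : Type*} {G : SimpleGraph V} {u v w : V} {k : ℕ∞}
    (h : G.edist u v ≤ k) (hvw : G.Adj v w) : G.edist u w ≤ k + 1 :=
  G.edist_triangle.trans (add_le_add h (SimpleGraph.edist_eq_one_iff_adj.2 hvw).le)

/-- A closed walk of length `6` along pairwise distinct vertices. -/
def IsHexagon {V : Type*} (G : SimpleGraph V) (a : Fin 6 → V) : Prop :=
  Function.Injective a ∧ ∀ i, G.Adj (a i) (a (i + 1))

theorem IsHexagon.rotate {V : Type*} {G : SimpleGraph V} {a : Fin 6 → V} (h : IsHexagon G a)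
    (k : Fin 6) : IsHexagon G fun i => a (k + i) :=
  ⟨fun i j hij => add_left_cancel (h.1 hij), fun i => by simpa [add_assoc] using h.2 (k + i)⟩

theorem not_cycleGraph_six_free_iff {V : Type*} {G : SimpleGraph V} :
    ¬ (SimpleGraph.cycleGraph 6).Free G ↔ ∃ a, IsHexagon G a := by
  rw [SimpleGraph.not_free]
  constructor
  · rintro ⟨f⟩
    refine ⟨f, f.injective, fun i => f.toHom.map_adj ?_⟩
    rw [SimpleGraph.cycleGraph_adj]
    simp
  · rintro ⟨a, ha, h⟩
    refine ⟨⟨⟨a, fun {i j} hij => ?_⟩, ha⟩⟩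
    rw [SimpleGraph.cycleGraph_adj] at hij
    rcases hij with hij | hij
    · rw [sub_eq_iff_eq_add'.1 hij]
      simpa using (h j).symm
    · rw [sub_eq_iff_eq_add'.1 hij]
      simpa [add_comm] using h i

/-! ### The gadget graphs -/

/-- The vertices of the gadget. There are two sides, each with the subdivision of a spanning
subgraph of `K_{m,m}`; the two copies of every vertex of `K_{m,m}` are adjacent, and all of them
are joined to a hub by paths of length `2` (`left`) or `3` (`right`). -/
inductive GadgetVertex (m k : ℕ) : Type
  | hub
  | pad (i : Fin k)
  | spokeL (s : Bool) (i : Fin m)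
  | left (s : Bool) (i : Fin m)
  | link (s : Bool) (i j : Fin m)
  | right (s : Bool) (j : Fin m)
  | outerR (s : Bool) (j : Fin m)
  | innerR (s : Bool) (j : Fin m)

namespace GadgetVertex

variable {m k : ℕ}

/-- The side of a vertex; the hub and its leaves are on side `false`. -/
def side : GadgetVertex m k → Bool
  | hub => false
  | pad _ => false
  | spokeL s _ => s
  | left s _ => s
  | link s _ _ => s
  | right s _ => s
  | outerR s _ => s
  | innerR s _ => s

/-- Adjacency in the gadget; the link between `left s i` and `right s j` is complete if
`x s i j`. -/
def Adj (x : Bool → Fin m → Fin m → Prop) : GadgetVertex m k → GadgetVertex m k → Prop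
  | hub, pad _ => True
  | pad _, hub => True
  | hub, spokeL _ _ => True
  | spokeL _ _, hub => True
  | hub, innerR _ _ => True
  | innerR _ _, hub => True
  | spokeL s i, left s' i' => s = s' ∧ i = i'
  | left s i, spokeL s' i' => s = s' ∧ i = i'
  | left s i, left s' i' => s ≠ s' ∧ i = i'
  | right s i, right s' i' => s ≠ s' ∧ i = i'
  | left s i, link s' i' _ => s = s' ∧ i = i'
  | link s i _, left s' i' => s = s' ∧ i = i'
  | right s j, link s' i' j' => s = s' ∧ j = j' ∧ x s' i' j'
  | link s i j, right s' j' => s = s' ∧ j = j' ∧ x s i j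
  | right s i, outerR s' i' => s = s' ∧ i = i'
  | outerR s i, right s' i' => s = s' ∧ i = i'
  | innerR s i, outerR s' i' => s = s' ∧ i = i'
  | outerR s i, innerR s' i' => s = s' ∧ i = i'
  | _, _ => False

/-- The vertices as a sum of products. -/
def equivSum : GadgetVertex m k ≃ Unit ⊕ Fin k ⊕ (Bool × Fin m) ⊕ (Bool × Fin m) ⊕
    (Bool × Fin m × Fin m) ⊕ (Bool × Fin m) ⊕ (Bool × Fin m) ⊕ (Bool × Fin m) where
  toFun
    | hub => .inl ()
    | pad i => .inr (.inl i)
    | spokeL s i => .inr (.inr (.inl (s, i)))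
    | left s i => .inr (.inr (.inr (.inl (s, i))))
    | link s i j => .inr (.inr (.inr (.inr (.inl (s, i, j)))))
    | right s i => .inr (.inr (.inr (.inr (.inr (.inl (s, i))))))
    | outerR s i => .inr (.inr (.inr (.inr (.inr (.inr (.inl (s, i)))))))
    | innerR s i => .inr (.inr (.inr (.inr (.inr (.inr (.inr (s, i)))))))
  invFun
    | .inl () => hub
    | .inr (.inl i) => pad i
    | .inr (.inr (.inl (s, i))) => spokeL s i
    | .inr (.inr (.inr (.inl (s, i)))) => left s i
    | .inr (.inr (.inr (.inr (.inl (s, i, j))))) => link s i j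
    | .inr (.inr (.inr (.inr (.inr (.inl (s, i)))))) => right s i
    | .inr (.inr (.inr (.inr (.inr (.inr (.inl (s, i))))))) => outerR s i
    | .inr (.inr (.inr (.inr (.inr (.inr (.inr (s, i))))))) => innerR s i
  left_inv v := by cases v <;> rfl
  right_inv v := by rcases v with _ | _ | _ | _ | _ | _ | _ | _ <;> rfl

instance : Fintype (GadgetVertex m k) := Fintype.ofEquiv _ equivSum.symm

theorem card_eq : Fintype.card (GadgetVertex m k) = 2 * m ^ 2 + 10 * m + 1 + k := by
  rw [Fintype.card_congr equivSum]
  simp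
  ring

end GadgetVertex

open GadgetVertex

variable {m k : ℕ}

/-- The gadget graph. -/
def gadget (k : ℕ) (x : Bool → Fin m → Fin m → Prop) : SimpleGraph (GadgetVertex m k) where
  Adj := Adj x
  symm := ⟨fun u v h => by cases u <;> cases v <;> simp_all [Adj] <;> grind⟩
  loopless := ⟨fun u h => by cases u <;> simp_all [Adj]⟩

section Neighbors

variable {x : Bool → Fin m → Fin m → Prop} {v : GadgetVertex m k} {s : Bool} {i j : Fin m}

theorem gadget_adj_hub : (gadget k x).Adj hub v ↔
    (∃ i, v = pad i) ∨ (∃ s i, v = spokeL s i) ∨ ∃ s i, v = innerR s i := by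
  cases v <;> simp [gadget, Adj]

theorem gadget_adj_pad {i : Fin k} : (gadget k x).Adj (pad i) v ↔ v = hub := by
  cases v <;> simp [gadget, Adj]

theorem gadget_adj_spokeL : (gadget k x).Adj (spokeL s i) v ↔ v = hub ∨ v = left s i := by
  cases v <;> simp [gadget, Adj, eq_comm]

theorem gadget_adj_left : (gadget k x).Adj (left s i) v ↔
    v = spokeL s i ∨ v = left (!s) i ∨ ∃ j, v = link s i j := by
  cases v <;> simp [gadget, Adj, eq_comm]
  cases s <;> simp

theorem gadget_adj_link : (gadget k x).Adj (link s i j) v ↔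
    v = left s i ∨ (x s i j ∧ v = right s j) := by
  cases v <;> simp [gadget, Adj, eq_comm]
  tauto

theorem gadget_adj_right : (gadget k x).Adj (right s j) v ↔
    v = outerR s j ∨ v = right (!s) j ∨ ∃ i, x s i j ∧ v = link s i j := by
  cases v <;> simp [gadget, Adj, eq_comm]
  · aesop
  · cases s <;> simp

theorem gadget_adj_outerR : (gadget k x).Adj (outerR s j) v ↔
    v = right s j ∨ v = innerR s j := by
  cases v <;> simp [gadget, Adj, eq_comm]

theorem gadget_adj_innerR : (gadget k x).Adj (innerR s j) v ↔
    v = hub ∨ v = outerR s j := by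
  cases v <;> simp [gadget, Adj, eq_comm]

end Neighbors

section Gadget

variable (x : Bool → Fin m → Fin m → Prop)

theorem edist_hub_le_three (v : GadgetVertex m k) : (gadget k x).edist hub v ≤ 3 := by
  have h0 : (gadget k x).edist hub hub ≤ 0 := by simp
  have hpad : ∀ i, (gadget k x).edist hub (pad i) ≤ 1 := fun i => by
    simpa using edist_le_add_one h0 (gadget_adj_hub.2 (Or.inl ⟨i, rfl⟩))
  have hspoke : ∀ s i, (gadget k x).edist hub (spokeL s i) ≤ 1 := fun s i => by
    simpa using edist_le_add_one h0 (gadget_adj_hub.2 (Or.inr (Or.inl ⟨s, i, rfl⟩)))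
  have hinner : ∀ s i, (gadget k x).edist hub (innerR s i) ≤ 1 := fun s i => by
    simpa using edist_le_add_one h0 (gadget_adj_hub.2 (Or.inr (Or.inr ⟨s, i, rfl⟩)))
  have hleft : ∀ s i, (gadget k x).edist hub (left s i) ≤ 1 + 1 := fun s i =>
    edist_le_add_one (hspoke s i) (gadget_adj_spokeL.2 (Or.inr rfl))
  have houter : ∀ s i, (gadget k x).edist hub (outerR s i) ≤ 1 + 1 := fun s i =>
    edist_le_add_one (hinner s i) (gadget_adj_innerR.2 (Or.inr rfl))
  cases v with
  | hub => simp
  | pad i => exact (hpad i).trans (by norm_num)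
  | spokeL s i => exact (hspoke s i).trans (by norm_num)
  | left s i => exact (hleft s i).trans (by norm_num)
  | link s i j =>
    exact (edist_le_add_one (hleft s i) (gadget_adj_left.2 (Or.inr (Or.inr ⟨j, rfl⟩)))).trans
      (by norm_num)
  | right s i =>
    exact (edist_le_add_one (houter s i) (gadget_adj_outerR.2 (Or.inl rfl))).trans (by norm_num)
  | outerR s i => exact (houter s i).trans (by norm_num)
  | innerR s i => exact (hinner s i).trans (by norm_num)

theorem gadget_ediam_le : (gadget k x).ediam ≤ 6 := by
  refine SimpleGraph.ediam_le_of_edist_le fun u v => ?_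
  refine ((gadget k x).edist_triangle (v := hub)).trans ?_
  rw [SimpleGraph.edist_comm]
  exact (add_le_add (edist_hub_le_three x u) (edist_hub_le_three x v)).trans (by norm_num)

theorem gadget_degeneracy (hm : 0 < m) : degeneracy (gadget k x) = 2 := by
  have hpair : ∀ {T : Set (GadgetVertex m k)} (a b), T ⊆ {a, b} → T.encard ≤ 2 := fun a b h =>
    (Set.encard_le_encard h).trans (Set.encard_insert_le _ _ |>.trans (by rw [Set.encard_singleton]; norm_num))
  let i : Fin m := ⟨0, hm⟩
  -- Removing all vertices of rank 0, each of degree at most 2, leaves the isolated hub and a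
  -- matching. The set `U` is a 5-cycle through the hub.
  refine degeneracy_eq_two
    (fun v => match v with | hub => 1 | left _ _ => 1 | right _ _ => 1 | _ => 0) (fun v => ?_)
    (U := {hub, spokeL true i, spokeL false i, left true i, left false i}) ⟨hub, by simp⟩ ?_
  · cases v with
    | hub => exact hpair hub hub (by rintro u ⟨h, h'⟩; cases u <;> simp_all [gadget, Adj])
    | pad i => exact hpair hub hub (by rintro u ⟨h, -⟩; simpa [gadget_adj_pad] using h)
    | spokeL s i =>
      exact hpair hub (left s i) (by rintro u ⟨h, -⟩; simpa [gadget_adj_spokeL] using h)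
    | left s i =>
      refine hpair (left (!s) i) (left (!s) i) ?_
      rintro u ⟨h, h'⟩
      rcases gadget_adj_left.1 h with rfl | rfl | ⟨j, rfl⟩ <;> simp_all
    | link s i j =>
      refine hpair (left s i) (right s j) ?_
      rintro u ⟨h, -⟩
      rcases gadget_adj_link.1 h with rfl | ⟨-, rfl⟩ <;> simp
    | right s j =>
      refine hpair (right (!s) j) (right (!s) j) ?_
      rintro u ⟨h, h'⟩
      rcases gadget_adj_right.1 h with rfl | rfl | ⟨i, -, rfl⟩ <;> simp_all
    | outerR s i =>
      exact hpair (right s i) (innerR s i) (by rintro u ⟨h, -⟩; simpa [gadget_adj_outerR] using h)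
    | innerR s i =>
      exact hpair hub (outerR s i) (by rintro u ⟨h, -⟩; simpa [gadget_adj_innerR] using h)
  · rintro v (rfl | rfl | rfl | rfl | rfl)
    · exact ⟨spokeL true i, by simp, spokeL false i, by simp, by simp, by simp [gadget, Adj]⟩
    · exact ⟨hub, by simp, left true i, by simp, by simp, by simp [gadget, Adj]⟩
    · exact ⟨hub, by simp, left false i, by simp, by simp, by simp [gadget, Adj]⟩
    · exact ⟨spokeL true i, by simp, left false i, by simp, by simp, by simp [gadget, Adj]⟩
    · exact ⟨spokeL false i, by simp, left true i, by simp, by simp, by simp [gadget, Adj]⟩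

/-! ### The 6-cycles of the gadget -/

section Hexagon

variable {x} {a : Fin 6 → GadgetVertex m k}

theorem IsHexagon.ne_and_adj {V : Type*} {G : SimpleGraph V} {a : Fin 6 → V}
    (h : IsHexagon G a) :
    (a 0 ≠ a 2 ∧ a 0 ≠ a 4 ∧ a 1 ≠ a 3 ∧ a 1 ≠ a 5 ∧ a 2 ≠ a 4 ∧ a 3 ≠ a 5) ∧
    G.Adj (a 0) (a 1) ∧ G.Adj (a 1) (a 2) ∧ G.Adj (a 2) (a 3) ∧
    G.Adj (a 4) (a 3) ∧ G.Adj (a 5) (a 4) ∧ G.Adj (a 0) (a 5) := by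
  refine ⟨⟨?_, ?_, ?_, ?_, ?_, ?_⟩, h.2 0, h.2 1, h.2 2, (h.2 3).symm, (h.2 4).symm, (h.2 5).symm⟩
  all_goals exact h.1.ne (by decide)

/-- The vertices at distance 2 from the hub are the `left` and `outerR` vertices, and no two
distinct ones have a common neighbor. A 6-cycle through the hub would have such a pair at `a 2` and
`a 4`, with common neighbor `a 3`. -/
theorem IsHexagon.zero_ne_hub (h : IsHexagon (gadget k x) a) : a 0 ≠ hub := by
  obtain ⟨⟨n02, n04, n13, n15, n24, n35⟩, h01, h12, h23, h43, h54, h05⟩ := h.ne_and_adj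
  clear h
  generalize a 0 = v0 at *
  generalize a 1 = v1 at *
  generalize a 2 = v2 at *
  generalize a 3 = v3 at *
  generalize a 4 = v4 at *
  generalize a 5 = v5 at *
  rintro rfl
  rcases gadget_adj_hub.1 h01 with ⟨i, rfl⟩ | ⟨s, i, rfl⟩ | ⟨s, i, rfl⟩
  · exact n02 (gadget_adj_pad.1 h12).symm
  all_goals
    rcases gadget_adj_hub.1 h05 with ⟨j, rfl⟩ | ⟨t, j, rfl⟩ | ⟨t, j, rfl⟩
    · exact n04 (gadget_adj_pad.1 h54).symm
    all_goals
      simp only [gadget_adj_spokeL, gadget_adj_innerR, n02.symm, n04.symm, false_or] at h12 h54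
      subst h12 h54
      simp only [gadget_adj_left, gadget_adj_outerR] at h23 h43
      cases s <;> cases t <;> grind

theorem IsHexagon.ne_hub (h : IsHexagon (gadget k x) a) (i : Fin 6) : a i ≠ hub := by
  simpa using (h.rotate i).zero_ne_hub

/-- Without the hub, the `pad`, `spokeL` and `innerR` vertices have degree at most 1 and cannot lie
on a cycle; after `innerR` is excluded, the same holds for `outerR`. -/
theorem IsHexagon.zero_inner (h : IsHexagon (gadget k x) a) :
    (∃ s i, a 0 = left s i) ∨ (∃ s i j, a 0 = link s i j) ∨ ∃ s j, a 0 = right s j := by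
  have key : ∀ a : Fin 6 → GadgetVertex m k, IsHexagon (gadget k x) a →
      ∀ s j, a 0 ≠ innerR s j := by
    intro a h s j h0
    have n15 : a 1 ≠ a 5 := h.1.ne (by decide)
    have h01 : (gadget k x).Adj (a 0) (a 1) := h.2 0
    have h05 : (gadget k x).Adj (a 0) (a 5) := (h.2 5).symm
    rw [h0, gadget_adj_innerR] at h01 h05
    have := h.ne_hub 1
    have := h.ne_hub 5
    grind
  obtain ⟨⟨-, -, -, n15, -, -⟩, h01, -, -, -, -, h05⟩ := h.ne_and_adj
  have := h.ne_hub 0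
  have := h.ne_hub 1
  have := h.ne_hub 5
  have k0 := key _ (h.rotate 0)
  have k1 := key _ (h.rotate 1)
  have k5 := key _ (h.rotate 5)
  simp only [add_zero] at k0 k1 k5
  clear h
  generalize a 0 = v0 at *
  generalize a 1 = v1 at *
  generalize a 5 = v5 at *
  cases v0 <;> grind [gadget_adj_pad, gadget_adj_spokeL, gadget_adj_outerR]

theorem IsHexagon.inner (h : IsHexagon (gadget k x) a) (n : Fin 6) :
    (∃ s i, a n = left s i) ∨ (∃ s i j, a n = link s i j) ∨ ∃ s j, a n = right s j := by
  simpa using (h.rotate n).zero_inner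

/-- The edges among `left` and `right` vertices form a matching, so a walk using only these returns
after two steps. -/
theorem IsHexagon.exists_link (h : IsHexagon (gadget k x) a) : ∃ n s i j, a n = link s i j := by
  by_contra! hc
  have n02 : a 0 ≠ a 2 := h.1.ne (by decide)
  have h01 : (gadget k x).Adj (a 0) (a 1) := h.2 0
  have h12 : (gadget k x).Adj (a 1) (a 2) := h.2 1
  have i0 := h.inner 0
  have i1 := h.inner 1
  have i2 := h.inner 2
  simp only [hc, exists_false, false_or] at i0 i1 i2
  rcases i0 with ⟨s, i, h0⟩ | ⟨s, i, h0⟩ <;> rcases i1 with ⟨t, j, h1⟩ | ⟨t, j, h1⟩ <;>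
    rcases i2 with ⟨u, l, h2⟩ | ⟨u, l, h2⟩ <;> rw [h0, h1] at h01 <;> rw [h1, h2] at h12 <;>
    rw [h0, h2] at n02 <;> simp [gadget, Adj] at h01 h12 n02 <;>
    cases s <;> cases t <;> cases u <;> grind

/-- The two cycle neighbors of the link are `left s i` and `right s j`, which forces `x s i j`. The
remaining path of length 4 between them cannot use another link on side `s`: a common neighbor at `a
3` would force that link to be `a 0` again. So it crosses to the other side at both ends and passes
through `link (!s) i j`. -/
theorem IsHexagon.intersect_of_zero (h : IsHexagon (gadget k x) a) {s : Bool} {i j : Fin m}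
    (h0 : a 0 = link s i j) : x s i j ∧ x (!s) i j := by
  obtain ⟨⟨n02, n04, n13, n15, n24, n35⟩, h01, h12, h23, h43, h54, h05⟩ := h.ne_and_adj
  have i2 := h.inner 2
  have i3 := h.inner 3
  have i4 := h.inner 4
  clear h
  generalize a 0 = v0 at *
  generalize a 1 = v1 at *
  generalize a 2 = v2 at *
  generalize a 3 = v3 at *
  generalize a 4 = v4 at *
  generalize a 5 = v5 at *
  subst h0
  rcases gadget_adj_link.1 h01 with rfl | ⟨hx, rfl⟩ <;>
    rcases gadget_adj_link.1 h05 with rfl | ⟨hx', rfl⟩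
  · exact absurd rfl n15
  · rcases gadget_adj_left.1 h12 with rfl | rfl | ⟨j', rfl⟩ <;>
      rcases gadget_adj_right.1 h54 with rfl | rfl | ⟨i', hx', rfl⟩ <;>
      grind [gadget_adj_left, gadget_adj_link, gadget_adj_right]
  · rcases gadget_adj_left.1 h54 with rfl | rfl | ⟨j', rfl⟩ <;>
      rcases gadget_adj_right.1 h12 with rfl | rfl | ⟨i', hx', rfl⟩ <;>
      grind [gadget_adj_left, gadget_adj_link, gadget_adj_right]
  · exact absurd rfl n15

theorem not_cycleGraph_six_free_gadget_iff :
    ¬ (SimpleGraph.cycleGraph 6).Free (gadget k x) ↔ ∃ i j, x true i j ∧ x false i j := by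
  rw [not_cycleGraph_six_free_iff]
  constructor
  · rintro ⟨a, h⟩
    obtain ⟨n, s, i, j, hn⟩ := h.exists_link
    have := (h.rotate n).intersect_of_zero (by simpa using hn)
    cases s
    · exact ⟨i, j, this.2, this.1⟩
    · exact ⟨i, j, this⟩
  · rintro ⟨i, j, h, h'⟩
    refine ⟨![link true i j, right true j, right false j, link false i j, left false i,
      left true i], ?_, ?_⟩
    · intro u v
      fin_cases u <;> fin_cases v <;> simp
    · intro u
      fin_cases u <;> simp [gadget, Adj, h, h']

end Hexagon

end Gadget

/-! ### Hybrid networks -/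

section Hybrid

variable {N : ℕ → ℕ} {n : ℕ}

theorem Network.mem_nbrs {G : Network N n} {u v : Fin n} : u ∈ G.nbrs v ↔ G.graph.Adj v u := by
  simp [Network.nbrs]

namespace Algorithm

variable (A : Algorithm)

open scoped Classical in
/-- The message which `u` sends to `v` in round `t + 1`; `none` if `u` is silent. -/
noncomputable def message (G : Network N n) (t : ℕ) (u v : Fin n) : Option (List Bool) :=
  if A.output (A.stateAt G t u) = none then some (A.send (A.stateAt G t u) (G.ident v)) else none

theorem message_eq_some {G : Network N n} {t : ℕ} {u v : Fin n} {l : List Bool} :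
    A.message G t u v = some l ↔ A.output (A.stateAt G t u) = none ∧
      A.send (A.stateAt G t u) (G.ident v) = l := by
  unfold message
  split_ifs with h <;> simp [h]

theorem mem_inbox {G : Network N n} {t : ℕ} {v : Fin n} {p : ℕ × List Bool} :
    p ∈ A.inbox G (A.stateAt G t) v ↔
      ∃ u ∈ G.nbrs v, A.message G t u v = some p.2 ∧ G.ident u = p.1 := by
  simp only [inbox, Finset.mem_image, Finset.mem_filter, message_eq_some, Prod.ext_iff]
  grind

theorem stateAt_of_output_ne_none {G : Network N n} {t t' : ℕ} {v : Fin n} (htt' : t ≤ t')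
    (h : A.output (A.stateAt G t v) ≠ none) : A.stateAt G t' v = A.stateAt G t v := by
  induction t', htt' using Nat.le_induction with
  | base => rfl
  | succ r _ ih => rw [stateAt, ih, if_neg h]

theorem output_eq_of_haltedAt {G : Network N n} {t : ℕ} (h : A.HaltedAt G t) {v : Fin n}
    (hv : A.AcceptsAt G v) : A.output (A.stateAt G t v) = some true := by
  obtain ⟨r, hr⟩ := hv
  rcases le_total r t with hrt | hrt
  · rwa [A.stateAt_of_output_ne_none hrt (by simp [hr])]
  · rwa [← A.stateAt_of_output_ne_none hrt (h v)]

/-- If `H` is glued from `G true` and `G false` along a cut across which the two networks send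
the same messages, then every node has the same state in `H` as in the network it comes from. -/
theorem stateAt_hybrid {G : Bool → Network N n} {H : Network N n} (σ : Fin n → Bool)
    (hid : ∀ b, (G b).ident = H.ident) (hnbrs : ∀ v, (G (σ v)).nbrs v = H.nbrs v) {R : ℕ}
    (hmsg : ∀ t < R, ∀ u v, H.graph.Adj u v → σ u ≠ σ v →
      A.message (G true) t u v = A.message (G false) t u v) :
    ∀ t ≤ R, ∀ v, A.stateAt H t v = A.stateAt (G (σ v)) t v := by
  intro t
  induction t with
  | zero =>
    intro _ v
    simp only [stateAt, hid, hnbrs]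
  | succ t ih =>
    intro ht v
    replace ih := ih (by omega)
    have hinbox : A.inbox H (A.stateAt H t) v = A.inbox (G (σ v)) (A.stateAt (G (σ v)) t) v := by
      ext p
      rw [mem_inbox, mem_inbox, hnbrs, hid]
      refine exists_congr fun u => and_congr_right fun hu => ?_
      -- The message depends only on the state of `u`, which is that in `G (σ u)`. If `u` lies
      -- across the cut from `v`, agreement at the cut replaces `G (σ u)` by `G (σ v)`.
      have huv : A.message H t u v = A.message (G (σ v)) t u v := by
        have h1 : A.message H t u v = A.message (G (σ u)) t u v := by
          simp only [message, ih u, hid]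
        by_cases huv : σ u = σ v
        · rw [h1, huv]
        · have := hmsg t (by omega) u v (Network.mem_nbrs.1 hu).symm huv
          rw [h1]
          cases hu : σ u <;> cases hv : σ v <;> simp_all
      rw [huv]
    simp only [stateAt]
    rw [ih v, hinbox]

theorem haltedAt_of_rounds_le {G : Network N n} {K : ℕ} (h : A.rounds G ≤ K) :
    A.HaltedAt G K := by
  by_contra hK
  have : ((K + 1 : ℕ) : ℕ∞) ≤ A.rounds G := by
    refine le_iInf₂ fun t ht => ?_
    have : K < t := by
      by_contra! htK
      exact hK fun v => by rw [A.stateAt_of_output_ne_none htK (ht v)]; exact ht v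
    exact_mod_cast this
  have := this.trans h
  norm_cast at this
  omega

end Algorithm

/-- If `H` is glued from `G true` and `G false` along a cut at which their nodes hold the same
certificates, and all nodes accept in `G true` and `G false`, then all nodes accept in `H`. -/
theorem CertScheme.acceptsAt_hybrid (S : CertScheme N) {G : Bool → Network N n}
    {H : Network N n} (σ : Fin n → Bool) (hid : ∀ b, (G b).ident = H.ident)
    (hnbrs : ∀ v, (G (σ v)).nbrs v = H.nbrs v) (c : Bool → Fin n → List Bool)
    (hc : ∀ u v, H.graph.Adj u v → σ u ≠ σ v → c true u = c false u)
    (hacc : ∀ b v, S.AcceptsAt (G b) (c b) v) (v : Fin n) :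
    S.AcceptsAt H (fun u => c (σ u) u) v := by
  have h := hacc (σ v) v
  unfold AcceptsAt at h ⊢
  rw [hnbrs, hid] at h
  convert h using 2
  refine Finset.image_congr fun u hu => ?_
  have : c (σ u) u = c (σ v) u := by
    by_cases huv : σ u = σ v
    · rw [huv]
    · have := hc u v (Network.mem_nbrs.1 hu).symm huv
      cases hu : σ u <;> cases hv : σ v <;> simp_all
  simp only [this]

end Hybrid

/-! ### Fooling sets -/

/-- An optional bit string, cut off after `b` bits. -/
def truncate (b : ℕ) (o : Option (List Bool)) : Option (Fin b → Option Bool) :=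
  o.map fun l i => l[(i : ℕ)]?

/-- Positions beyond the end of a string read `none`, so the truncation also records the length. -/
theorem truncate_injOn (b : ℕ) :
    Set.InjOn (truncate b) {o | ∀ l, o = some l → l.length ≤ b} := by
  rintro (_ | l) hl (_ | l') hl' h
  · rfl
  · simp [truncate] at h
  · simp [truncate] at h
  · simp only [truncate, Option.map_some, Option.some.injEq] at h
    congr 1
    refine List.ext_getElem? fun i => ?_
    by_cases hi : i < b
    · exact congrFun h ⟨i, hi⟩
    · have h1 := hl l rfl
      have h2 := hl' l' rfl
      rw [List.getElem?_eq_none (by omega), List.getElem?_eq_none (by omega)]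

/-- Pigeonhole: there are more sets than possible families of short strings, so two distinct sets
share a family, and some element separates them. -/
theorem exists_fooling_pair {α ι : Type*} [Fintype α] [Fintype ι] {b : ℕ}
    (f : Set α → ι → Option (List Bool)) (hf : ∀ S c l, f S c = some l → l.length ≤ b)
    (hcard : Fintype.card ι * (2 * (b + 1)) < Fintype.card α) :
    ∃ (F : Bool → Set α) (a : α), a ∈ F true ∧ a ∉ F false ∧ f (F true) = f (F false) := by
  classical
  have hlt : Fintype.card (ι → Option (Fin b → Option Bool)) < Fintype.card (Set α) := by
    simp only [Fintype.card_fun, Fintype.card_option, Fintype.card_bool, Fintype.card_fin,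
      Fintype.card_set]
    -- Each truncated entry is `none` or one of `3 ^ b` functions, so it is worth at most `2 * (b +
    -- 1)` bits.
    have h3 : (2 + 1) ^ b + 1 ≤ 2 ^ (2 * (b + 1)) := by
      have : (2 + 1) ^ b ≤ 4 ^ b := Nat.pow_le_pow_left (by norm_num) b
      have h1 : 1 ≤ 4 ^ b := Nat.one_le_pow _ _ (by norm_num)
      rw [pow_mul, pow_succ]
      norm_num at *
      omega
    calc ((2 + 1) ^ b + 1) ^ Fintype.card ι ≤ (2 ^ (2 * (b + 1))) ^ Fintype.card ι :=
          Nat.pow_le_pow_left h3 _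
      _ = 2 ^ (Fintype.card ι * (2 * (b + 1))) := by rw [← pow_mul, mul_comm]
      _ < 2 ^ Fintype.card α := Nat.pow_lt_pow_right (by norm_num) hcard
  obtain ⟨S, T, hST, h⟩ := Fintype.exists_ne_map_eq_of_card_lt
    (fun (S : Set α) c => truncate b (f S c)) hlt
  have hfST : f S = f T := funext fun c =>
    truncate_injOn b (hf S c) (hf T c) (congrFun h c)
  obtain ⟨a, ha⟩ : ∃ a, ¬ (a ∈ S ↔ a ∈ T) := by
    by_contra! hc
    exact hST (Set.ext hc)
  -- The roles of the two sets are chosen so that `a` lies in `F true`.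
  by_cases haS : a ∈ S
  · exact ⟨fun s => if s then S else T, a, by simpa, by simpa [haS] using ha, by simpa⟩
  · exact ⟨fun s => if s then T else S, a, by simpa [haS] using ha, by simpa, by simp [hfST]⟩

/-! ### The gadget as a network -/

/-- The only edges depending on the input join a link to a `right` vertex, and both lie on the side
whose input decides them. -/
theorem gadget_adj_congr {x y : Bool → Fin m → Fin m → Prop} {u v : GadgetVertex m k}
    (h : x u.side = y u.side) : (gadget k x).Adj u v ↔ (gadget k y).Adj u v := by
  cases u <;> cases v <;> simp_all [gadget, GadgetVertex.Adj, side] <;> grind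

/-- The edges of the gadget between the two sides, in both directions. -/
def cutEdge : Fin 4 × Fin m × Bool → GadgetVertex m k × GadgetVertex m k
  | (q, i, true) =>
    (![left true i, right true i, spokeL true i, innerR true i] q,
      ![left false i, right false i, hub, hub] q)
  | (q, i, false) =>
    (![left false i, right false i, hub, hub] q,
      ![left true i, right true i, spokeL true i, innerR true i] q)

theorem cutEdge_adj (x : Bool → Fin m → Fin m → Prop) (c : Fin 4 × Fin m × Bool) :
    (gadget k x).Adj (cutEdge c).1 (cutEdge c).2 := by
  obtain ⟨q, i, s⟩ := c
  cases s <;> fin_cases q <;> simp [gadget, GadgetVertex.Adj, cutEdge]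

/-- As the hub belongs to side `false`, the crossing edges are the two matchings and the edges from
the hub to side `true`. -/
theorem exists_cutEdge_eq {x : Bool → Fin m → Fin m → Prop} {u v : GadgetVertex m k}
    (h : (gadget k x).Adj u v) (hs : u.side ≠ v.side) : ∃ c, cutEdge c = (u, v) := by
  cases u <;> cases v <;> simp [gadget, GadgetVertex.Adj, side] at h hs
  case hub.spokeL s i => exact ⟨(2, i, false), by simp [cutEdge, hs]⟩
  case spokeL.hub s i => exact ⟨(2, i, true), by simp [cutEdge, hs]⟩
  case hub.innerR s i => exact ⟨(3, i, false), by simp [cutEdge, hs]⟩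
  case innerR.hub s i => exact ⟨(3, i, true), by simp [cutEdge, hs]⟩
  case left.left s i t j =>
    refine ⟨(0, i, s), ?_⟩
    cases s <;> cases t <;> simp_all [cutEdge]
  case right.right s i t j =>
    refine ⟨(1, i, s), ?_⟩
    cases s <;> cases t <;> simp_all [cutEdge]
  all_goals grind

section GadgetNetwork

variable {N : ℕ → ℕ} {n : ℕ}

/-- The gadget with its vertices numbered by `e`. -/
def gadgetGraph (e : Fin n ≃ GadgetVertex m k) (x : Bool → Fin m → Fin m → Prop) :
    SimpleGraph (Fin n) :=
  (gadget k x).comap e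

/-- The numbering as an isomorphism onto the gadget. -/
def gadgetGraphIso (e : Fin n ≃ GadgetVertex m k) (x : Bool → Fin m → Fin m → Prop) :
    gadgetGraph e x ≃g gadget k x :=
  ⟨e, Iff.rfl⟩

theorem gadgetGraph_mem_degTwoDiamSix (hm : 0 < m) (e : Fin n ≃ GadgetVertex m k)
    (x : Bool → Fin m → Fin m → Prop) : degTwoDiamSix n (gadgetGraph e x) :=
  ⟨(degeneracy_congr (gadgetGraphIso e x)).trans (gadget_degeneracy x hm),
    ediam_le_of_iso (gadgetGraphIso e x) (gadget_ediam_le x)⟩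

theorem c6Free_gadgetGraph_iff (e : Fin n ≃ GadgetVertex m k)
    (x : Bool → Fin m → Fin m → Prop) :
    C6Free n (gadgetGraph e x) ↔ ∀ i j, ¬ (x true i j ∧ x false i j) := by
  rw [C6Free, SimpleGraph.free_congr_right (gadgetGraphIso e x), ← not_iff_not,
    not_cycleGraph_six_free_gadget_iff]
  push Not
  rfl

/-- The gadget as a network. -/
def gadgetNetwork (hN : n ≤ N n) (e : Fin n ≃ GadgetVertex m k)
    (x : Bool → Fin m → Fin m → Prop) : Network N n where
  graph := gadgetGraph e x
  connected := by
    have : Nonempty (Fin n) := ⟨e.symm hub⟩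
    refine SimpleGraph.connected_of_ediam_ne_top fun h => ?_
    have := ediam_le_of_iso (gadgetGraphIso e x) (gadget_ediam_le x)
    rw [h] at this
    exact absurd this (by decide)
  ident v := v + 1
  ident_injective u v h := by simpa [Fin.ext_iff] using h
  ident_mem v := by
    have := v.2
    simp
    omega

/-- Side `true` holds the set `S` and side `false` its complement. -/
def complementary (S : Set (Fin m × Fin m)) (s : Bool) (i j : Fin m) : Prop :=
  (i, j) ∈ S ↔ s = true

theorem c6Free_complementary (e : Fin n ≃ GadgetVertex m k) (S : Set (Fin m × Fin m)) :
    C6Free n (gadgetGraph e (complementary S)) := by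
  rw [c6Free_gadgetGraph_iff]
  simp [complementary]

theorem gadgetNetwork_nbrs_congr (hN : n ≤ N n) (e : Fin n ≃ GadgetVertex m k)
    {x y : Bool → Fin m → Fin m → Prop} {v : Fin n} (h : x (e v).side = y (e v).side) :
    (gadgetNetwork hN e x).nbrs v = (gadgetNetwork hN e y).nbrs v := by
  ext u
  rw [Network.mem_nbrs, Network.mem_nbrs]
  exact gadget_adj_congr h

/-- Side `true` holds `F true` and side `false` the complement of `F false`; both contain `a`. -/
theorem not_c6Free_hybrid (e : Fin n ≃ GadgetVertex m k) {F : Bool → Set (Fin m × Fin m)}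
    {a : Fin m × Fin m} (ha : a ∈ F true) (ha' : a ∉ F false) :
    ¬ C6Free n (gadgetGraph e fun s => complementary (F s) s) := by
  rw [c6Free_gadgetGraph_iff]
  push Not
  exact ⟨a.1, a.2, by simpa [complementary] using ha, by simpa [complementary] using ha'⟩

theorem exists_equiv_gadgetVertex (hn : n = 2 * m ^ 2 + 10 * m + 1 + k) :
    Nonempty (Fin n ≃ GadgetVertex m k) :=
  Fintype.card_eq.1 (by rw [card_eq, Fintype.card_fin, hn])

/-- A deciding algorithm has to send `m ^ 2` bits through the cut. -/
theorem le_of_roundComplexity_le (hm : 0 < m) (hn : n = 2 * m ^ 2 + 10 * m + 1 + k)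
    (hN : n ≤ N n) {A : Algorithm} {B K : ℕ} (hB : A.HasBandwidth N degTwoDiamSix B)
    (hA : A.Decides N degTwoDiamSix C6Free)
    (hK : A.roundComplexity N degTwoDiamSix n ≤ K) : m ≤ 16 * K * (B * Nat.log 2 n + 1) := by
  obtain ⟨e⟩ := exists_equiv_gadgetVertex hn
  by_contra! hlt
  let net := fun S => gadgetNetwork hN e (complementary S)
  let f : Set (Fin m × Fin m) → Fin K × (Fin 4 × Fin m × Bool) → Option (List Bool) := fun S c =>
    A.message (net S) c.1 (e.symm (cutEdge c.2).1) (e.symm (cutEdge c.2).2)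
  obtain ⟨F, a, ha, ha', hF⟩ := exists_fooling_pair (b := B * Nat.log 2 n) f
    (fun S c l h => by
      obtain ⟨h1, rfl⟩ := A.message_eq_some.1 h
      refine hB n (net S) (gadgetGraph_mem_degTwoDiamSix hm e _) _ _ _ ?_ h1
      simpa [net, gadgetNetwork, gadgetGraph] using cutEdge_adj (complementary S) c.2)
    (by
      simp only [Fintype.card_prod, Fintype.card_fin, Fintype.card_bool]
      -- There are `8 * m` directed cut edges in each of `K` rounds, each worth `2 * (B * Nat.log 2
      -- n + 1)` bits, against `m * m` elements.
      calc K * (4 * (m * 2)) * (2 * (B * Nat.log 2 n + 1))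
          = 16 * K * (B * Nat.log 2 n + 1) * m := by ring
        _ < m * m := Nat.mul_lt_mul_of_pos_right hlt hm)
  have hhalt : ∀ S, A.HaltedAt (net S) K := fun S => A.haltedAt_of_rounds_le <| by
    refine le_trans ?_ hK
    exact le_iSup₂_of_le n le_rfl (le_iSup₂_of_le (net S)
      (gadgetGraph_mem_degTwoDiamSix hm e _) le_rfl)
  have hstate := A.stateAt_hybrid (G := fun b => net (F b))
    (H := gadgetNetwork hN e fun s => complementary (F s) s) (fun v => (e v).side)
    (fun _ => rfl) (fun v => gadgetNetwork_nbrs_congr hN e rfl) (R := K)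
    (fun t ht u v huv hs => by
      obtain ⟨c, hc⟩ := exists_cutEdge_eq huv hs
      have := congrFun hF (⟨t, ht⟩, c)
      simpa [f, hc] using this) K le_rfl
  -- By round `K` every node of the hybrid has the state it has in a 6-cycle-free network, where it
  -- has accepted by then; so the algorithm wrongly declares the hybrid free of 6-cycles.
  refine not_c6Free_hybrid e ha ha' (((hA n (gadgetNetwork hN e _)
    (gadgetGraph_mem_degTwoDiamSix hm e _)).2).2 fun v => ⟨K, ?_⟩)
  rw [hstate v]
  exact A.output_eq_of_haltedAt (hhalt _) (((hA n (net _)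
    (gadgetGraph_mem_degTwoDiamSix hm e _)).2).1 (c6Free_complementary e _) v)

/-- The certificates at the cut have `m ^ 2` bits in total. -/
theorem le_of_certSize_le (hm : 0 < m) (hn : n = 2 * m ^ 2 + 10 * m + 1 + k)
    (hN : n ≤ N n) {S : CertScheme N} {K : ℕ} (hS : S.Certifies degTwoDiamSix C6Free)
    (hK : S.certSize degTwoDiamSix C6Free n ≤ K) : m ≤ 16 * (K + 1) := by
  obtain ⟨e⟩ := exists_equiv_gadgetVertex hn
  by_contra! hlt
  let net := fun S => gadgetNetwork hN e (complementary S)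
  let f : Set (Fin m × Fin m) → Fin 4 × Fin m × Bool → Option (List Bool) := fun T c =>
    some (S.prover (net T) (e.symm (cutEdge c).1))
  obtain ⟨F, a, ha, ha', hF⟩ := exists_fooling_pair (b := K) f
    (fun T c l h => by
      obtain rfl := Option.some_injective _ h
      have : ((S.prover (net T) (e.symm (cutEdge c).1)).length : ℕ∞) ≤ K := by
        refine le_trans ?_ hK
        exact le_iSup₂_of_le (net T) (gadgetGraph_mem_degTwoDiamSix hm e _)
          (le_iSup₂_of_le (c6Free_complementary e _) (e.symm (cutEdge c).1) le_rfl)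
      exact_mod_cast this)
    (by
      simp only [Fintype.card_prod, Fintype.card_fin, Fintype.card_bool]
      calc 4 * (m * 2) * (2 * (K + 1)) = 16 * (K + 1) * m := by ring
        _ < m * m := Nat.mul_lt_mul_of_pos_right hlt hm)
  have hacc := S.acceptsAt_hybrid (G := fun b => net (F b))
    (H := gadgetNetwork hN e fun s => complementary (F s) s) (fun v => (e v).side)
    (fun _ => rfl) (fun v => gadgetNetwork_nbrs_congr hN e rfl)
    (fun b => S.prover (net (F b)))
    (fun u v huv hs => by
      obtain ⟨c, hc⟩ := exists_cutEdge_eq huv hs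
      simpa [f, hc] using congrFun hF c)
    (fun b v => (hS n _ (gadgetGraph_mem_degTwoDiamSix hm e _)).1 (c6Free_complementary e _) v)
  obtain ⟨v, hv⟩ := (hS n (gadgetNetwork hN e fun s => complementary (F s) s)
    (gadgetGraph_mem_degTwoDiamSix hm e _)).2 (not_c6Free_hybrid e ha ha') _
  exact hv (hacc v)

/-- A gadget of order `n` with `m` of order `√n`. -/
theorem exists_gadget_parameters (hn : 13 ≤ n) :
    ∃ m k : ℕ, 0 < m ∧ n = 2 * m ^ 2 + 10 * m + 1 + k ∧ Real.sqrt n ≤ 8 * m := by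
  -- With `m = √(n / 13)` rounded down, `2 * m ^ 2 + 10 * m + 1 ≤ 13 * m ^ 2 ≤ n`, and pads fill the
  -- rest. Conversely `n < 13 * (m + 1) ^ 2 ≤ 52 * m ^ 2`, which gives the factor 8.
  have h1 : Nat.sqrt (n / 13) ^ 2 ≤ n / 13 := Nat.sqrt_le' _
  have h2 : n / 13 < (Nat.sqrt (n / 13) + 1) ^ 2 := Nat.lt_succ_sqrt' _
  have h3 : 0 < Nat.sqrt (n / 13) := Nat.sqrt_pos.2 (by omega)
  generalize Nat.sqrt (n / 13) = m at *
  have h4 : m ≤ m ^ 2 := Nat.le_self_pow (by norm_num) m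
  refine ⟨m, n - (2 * m ^ 2 + 10 * m + 1), h3, by omega, ?_⟩
  rw [Real.sqrt_le_left (by positivity)]
  have : n ≤ (8 * m) ^ 2 := by
    have : (m + 1) ^ 2 ≤ 4 * m ^ 2 := by nlinarith
    have : (8 * m) ^ 2 = 64 * m ^ 2 := by ring
    omega
  exact_mod_cast this

end GadgetNetwork

/-! ### Passage to the asymptotic bounds -/

/-- An infinite complexity satisfies every lower bound, so only natural values need an argument. -/
theorem ofReal_le_natCast_of_le {c : ℝ} {K : ℕ∞} (h : ∀ k : ℕ, K = k → c ≤ k) :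
    ENNReal.ofReal c ≤ (K : ℝ≥0∞) := by
  induction K using ENat.recTopCoe with
  | top => simp
  | coe k =>
    rw [ENat.toENNReal_coe]
    exact ENNReal.ofReal_le_of_le_toReal (by simpa using h k rfl)

theorem natLog_two_le {n : ℕ} : (Nat.log 2 n : ℝ) ≤ 2 * Real.log n := by
  have h1 : (Nat.log 2 n : ℝ) ≤ Real.logb 2 n := Real.natLog_le_logb n 2
  have h2 := Real.log_two_gt_d9
  have h3 : (0 : ℝ) ≤ Real.log n := Real.log_natCast_nonneg n
  refine h1.trans ?_
  rw [Real.logb, div_le_iff₀ (by linarith)]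
  nlinarith

end Congest

theorem theorem8 :
    -- deciding
    (∃ p : ℕ, ∀ B : ℕ, ∃ c : ℝ, 0 < c ∧ ∃ n₀ : ℕ,
      ∀ N : ℕ → ℕ, Congest.IsPolyBound N →
      ∀ A : Congest.Algorithm,
        A.HasBandwidth N Congest.degTwoDiamSix B →
        A.Decides N Congest.degTwoDiamSix Congest.C6Free →
        ∀ n : ℕ, n₀ ≤ n →
          ENNReal.ofReal (c * Real.sqrt n / Real.log n ^ p) ≤
            (A.roundComplexity N Congest.degTwoDiamSix n : ℝ≥0∞)) ∧
    -- certifying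
    (∃ (p : ℕ) (c : ℝ), 0 < c ∧ ∃ n₀ : ℕ,
      ∀ N : ℕ → ℕ, Congest.IsPolyBound N →
      ∀ S : Congest.CertScheme N,
        S.Certifies Congest.degTwoDiamSix Congest.C6Free →
        ∀ n : ℕ, n₀ ≤ n →
          ENNReal.ofReal (c * Real.sqrt n / Real.log n ^ p) ≤
            (S.certSize Congest.degTwoDiamSix Congest.C6Free n : ℝ≥0∞)) := by
  constructor
  -- Here `128 = 8 * 16` combines `√n ≤ 8 * m` with the cut bound. From `n ≥ 13` follows `log n ≥
  -- 1`, which absorbs the additive 1 into `(2 * B + 1) * log n`.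
  · refine ⟨1, fun B => ⟨1 / (128 * (2 * B + 1)), by positivity, 13, ?_⟩⟩
    intro N hN A hB hA n hn
    refine Congest.ofReal_le_natCast_of_le fun K hK => ?_
    obtain ⟨m, k, hm, hnm, hsqrt⟩ := Congest.exists_gadget_parameters hn
    have h : (m : ℝ) ≤ 16 * K * (B * Nat.log 2 n + 1) := by
      exact_mod_cast Congest.le_of_roundComplexity_le hm hnm (hN.1 n) hB hA hK.le
    have hlog : 1 ≤ Real.log n := by
      rw [Real.le_log_iff_exp_le (by positivity)]
      have : (13 : ℝ) ≤ n := by exact_mod_cast hn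
      linarith [Real.exp_one_lt_d9]
    have hb : B * (Nat.log 2 n : ℝ) + 1 ≤ (2 * B + 1) * Real.log n := by
      have := mul_le_mul_of_nonneg_left (Congest.natLog_two_le (n := n)) (Nat.cast_nonneg (α := ℝ) B)
      linarith
    rw [pow_one, div_le_iff₀ (by linarith), one_div, inv_mul_le_iff₀ (by positivity)]
    have := mul_le_mul_of_nonneg_left hb (by positivity : (0 : ℝ) ≤ 128 * K)
    linarith
  -- The cut bound gives `√n ≤ 128 * (K + 1)`; for `√n ≥ 256` the additive 128 costs at most half of
  -- `√n`, hence `1 / 256` and no logarithm.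
  · refine ⟨0, 1 / 256, by norm_num, 256 ^ 2, ?_⟩
    intro N hN S hS n hn
    refine Congest.ofReal_le_natCast_of_le fun K hK => ?_
    obtain ⟨m, k, hm, hnm, hsqrt⟩ := Congest.exists_gadget_parameters (by omega : 13 ≤ n)
    have h : (m : ℝ) ≤ 16 * (K + 1) := by
      exact_mod_cast Congest.le_of_certSize_le hm hnm (hN.1 n) hS hK.le
    have h256 : (256 : ℝ) ≤ Real.sqrt n := Real.le_sqrt_of_sq_le (by exact_mod_cast hn)
    rw [pow_zero, div_one]
    linarith
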